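/- **Model.** Sellers have types $\theta\in\Theta=[\underline\theta,\overline\theta]$, distributed according to a continuous c.d.f. $F$ (an atomless probability measure on $\Theta$). Type $\theta$ produces quality $q\ge 0$ at cost $C(q,\theta)$, where $C$ is twice continuously differentiable on $[0,\infty)\times\Theta$ with $C_q\ge0$, $C_\theta\le0$, $C_{qq}\ge0$, $C_{q\theta}\le0$, $C(0,\theta)=0$ and $C_q(0,\theta)=0$. For every $\theta\in\Theta$ the first-best condition $C_q(x,\theta)=1$ has a solution $x\ge 0$; each solution is called a first-best quality of type $\theta$, and if it is unique it is denoted $q^{FB}(\theta)$. A *quality allocation* is a measurable, $F$-integrable $q:\Theta\to[0,\infty)$. A *rating system* $(\pi,S)$ is a measurable space $S$ of signals with a Markov kernel $\pi(\cdot\mid x)$ from qualities $x$ to $S$. An *equilibrium* of $(\pi,S)$ is a quality allocation $q$ together with a measurable price function $p:S\to[0,\infty)$, integrable with respect to $\pi(\cdot\mid x)$ for every $x\ge0$, such that 1. $p(s)=\mathbb E[q\mid s]$ almost surely under the joint law of types and signals in which $\theta\sim F$ and $s\sim\pi(\cdot\mid q(\theta))$; 2. for every $\theta\in\Theta$, $q(\theta)\in\arg\max_{x\ge0}\int_S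 p(s)\,\pi(ds\mid x)-C(x,\theta)$; 3. for every $\theta\in\Theta$, $\Pi(\theta):=\int_S p(s)\,\pi(ds\mid q(\theta))-C(q(\theta),\theta)\ge0$. Given welfare weights $\lambda:\Theta\to[0,\infty)$ that are strictly increasing, a rating system with an equilibrium of it is *high-quality optimal* if it maximizes $\int_\Theta\lambda(\theta)\Pi(\theta)\,dF(\theta)$ over all equilibria of all rating systems; a quality allocation is high-quality optimal if it is the quality allocation of such an equilibrium. The rating system is *fully revealing* in an equilibrium if there is a measurable $g:S\to\mathbb R$ such that $g(s)=q(\theta)$ for $\pi(\cdot\mid q(\theta))$-almost every $s$, for $F$-almost every $\theta$. **Proposition.** (i) A quality allocation $q$ agrees $F$-almost everywhere with a high-quality optimal allocation if and only if $C_q(q(\theta),\theta)=1$ for $F$-almost every $\theta$; that is, if $q^{FB}$ is unique, if and only if $q=q^{FB}$ $F$-almost everywhere. Moreover, every quality allocation with $C_q(q(\theta),\theta)=1$ for all $\theta\in\Theta$ is itself high-quality optimal. (ii) Every high-quality optimal rating system is fully revealing. -/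

import Mathlib

open MeasureTheory ProbabilityTheory Set

noncomputable section

namespace RatingDesign

/-- Marginal cost `C_q(x, θ)`; qualities range over `[0, ∞)`, so the derivative at `0` is
one-sided. -/
def Cq (C : ℝ → ℝ → ℝ) (x θ : ℝ) : ℝ :=
  derivWithin (fun y => C y θ) (Ici 0) x

/-- `C_θ(x, θ)`, with one-sided derivatives at the end points of the type space `[θl, θh]`. -/
def Cθ (C : ℝ → ℝ → ℝ) (θl θh x θ : ℝ) : ℝ :=
  derivWithin (fun t => C x t) (Icc θl θh) θ

/-- `C_qq(x, θ)`. -/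
def Cqq (C : ℝ → ℝ → ℝ) (x θ : ℝ) : ℝ :=
  derivWithin (fun y => Cq C y θ) (Ici 0) x

/-- `C_qθ(x, θ)`. -/
def Cqθ (C : ℝ → ℝ → ℝ) (θl θh x θ : ℝ) : ℝ :=
  derivWithin (fun t => Cq C x t) (Icc θl θh) θ

/-- The assumptions on the cost `C q θ` of producing quality `q ≥ 0` as type `θ ∈ [θl, θh]`. -/
structure IsCost (C : ℝ → ℝ → ℝ) (θl θh : ℝ) : Prop where
  smooth : ContDiffOn ℝ 2 (fun z : ℝ × ℝ => C z.1 z.2) (Ici 0 ×ˢ Icc θl θh)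
  q_nonneg : ∀ x, 0 ≤ x → ∀ θ ∈ Icc θl θh, 0 ≤ Cq C x θ
  θ_nonpos : ∀ x, 0 ≤ x → ∀ θ ∈ Icc θl θh, Cθ C θl θh x θ ≤ 0
  qq_nonneg : ∀ x, 0 ≤ x → ∀ θ ∈ Icc θl θh, 0 ≤ Cqq C x θ
  qθ_nonpos : ∀ x, 0 ≤ x → ∀ θ ∈ Icc θl θh, Cqθ C θl θh x θ ≤ 0
  zero : ∀ θ ∈ Icc θl θh, C 0 θ = 0
  q_zero : ∀ θ ∈ Icc θl θh, Cq C 0 θ = 0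

/-- `x` is a first-best quality for type `θ`: the first-order condition `C_q(x, θ) = 1`. -/
def IsFirstBest (C : ℝ → ℝ → ℝ) (θ x : ℝ) : Prop :=
  0 ≤ x ∧ Cq C x θ = 1

/-- A rating system: a signal space and, for every quality `x`, a probability distribution
`rating x` of the signal (only qualities `x ≥ 0` are ever chosen). -/
structure RatingSystem where
  Signal : Type
  [measurableSpace : MeasurableSpace Signal]
  rating : Kernel ℝ Signal
  [markov : IsMarkovKernel rating]

attribute [instance] RatingSystem.measurableSpace RatingSystem.markov

/-- A quality allocation: types `θ ∈ [θl, θh]`, distributed as `F`, produce qualities `q θ ≥ 0`,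
with finite mean quality. -/
structure IsAllocation (θl θh : ℝ) (F : Measure ℝ) (q : ℝ → ℝ) : Prop where
  measurable : Measurable q
  nonneg : ∀ θ ∈ Icc θl θh, 0 ≤ q θ
  integrable : Integrable q F

/-- The joint law of type and signal when types are distributed as `F` and type `θ` chooses
quality `q θ`. -/
def jointLaw (F : Measure ℝ) (R : RatingSystem) (q : ℝ → ℝ) (hq : Measurable q) :
    Measure (ℝ × R.Signal) :=
  F ⊗ₘ (R.rating.comap q hq)

/-- The expected price of a seller of quality `x` when signal `s` is priced at `p s`. -/
def expectedPrice (R : RatingSystem) (p : R.Signal → ℝ) (x : ℝ) : ℝ :=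
  ∫ s, p s ∂(R.rating x)

/-- The payoff of a seller of type `θ` who produces quality `x`. -/
def payoff (C : ℝ → ℝ → ℝ) (R : RatingSystem) (p : R.Signal → ℝ) (x θ : ℝ) : ℝ :=
  expectedPrice R p x - C x θ

/-- `(q, p)` is an equilibrium of the rating system `R`. The price `p s` is the conditional
expectation `E[q | s]`; at signals off the path of play it is the mean of an arbitrary belief over
qualities, so it is only required to be nonnegative. Expected prices are finite at every quality. -/
structure IsEquilibrium (C : ℝ → ℝ → ℝ) (θl θh : ℝ) (F : Measure ℝ) (R : RatingSystem)
    (q : ℝ → ℝ) (p : R.Signal → ℝ) : Prop where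
  allocation : IsAllocation θl θh F q
  price_measurable : Measurable p
  price_nonneg : ∀ s, 0 ≤ p s
  price_integrable : ∀ x, 0 ≤ x → Integrable p (R.rating x)
  price_eq : (fun z : ℝ × R.Signal => p z.2)
    =ᵐ[jointLaw F R q allocation.measurable]
      (jointLaw F R q allocation.measurable)[fun z => q z.1 |
        MeasurableSpace.comap Prod.snd R.measurableSpace]
  incentive : ∀ θ ∈ Icc θl θh, ∀ x, 0 ≤ x → payoff C R p x θ ≤ payoff C R p (q θ) θ
  participation : ∀ θ ∈ Icc θl θh, 0 ≤ payoff C R p (q θ) θ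

/-- Weighted seller surplus `∫ λ(θ) Π(θ) dF(θ)`. -/
def welfare (C : ℝ → ℝ → ℝ) (F : Measure ℝ) (lam : ℝ → ℝ) (R : RatingSystem)
    (q : ℝ → ℝ) (p : R.Signal → ℝ) : ℝ :=
  ∫ θ, lam θ * payoff C R p (q θ) θ ∂F

/-- The rating system `R` with its equilibrium `(q, p)` is optimal for the welfare weights `lam`:
it maximizes weighted surplus over all equilibria of all rating systems. -/
def IsOptimalRating (C : ℝ → ℝ → ℝ) (θl θh : ℝ) (F : Measure ℝ) (lam : ℝ → ℝ) (R : RatingSystem)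
    (q : ℝ → ℝ) (p : R.Signal → ℝ) : Prop :=
  IsEquilibrium C θl θh F R q p ∧
    ∀ (R' : RatingSystem) (q' : ℝ → ℝ) (p' : R'.Signal → ℝ),
      IsEquilibrium C θl θh F R' q' p' → welfare C F lam R' q' p' ≤ welfare C F lam R q p

/-- The quality allocation `q` is optimal for the welfare weights `lam`. -/
def IsOptimalAllocation (C : ℝ → ℝ → ℝ) (θl θh : ℝ) (F : Measure ℝ) (lam : ℝ → ℝ)
    (q : ℝ → ℝ) : Prop :=
  ∃ (R : RatingSystem) (p : R.Signal → ℝ), IsOptimalRating C θl θh F lam R q p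

/-- `R` fully reveals the qualities chosen under `q`: almost surely, the quality can be read off
from the signal. -/
def FullyRevealing (F : Measure ℝ) (R : RatingSystem) (q : ℝ → ℝ) : Prop :=
  ∃ g : R.Signal → ℝ, Measurable g ∧ ∀ᵐ θ ∂F, ∀ᵐ s ∂(R.rating (q θ)), g s = q θ

end RatingDesign

end

/-! ### Monotonicity of costs and concavity of surplus -/

namespace RatingDesign

/-! Let S(θ) be the maximum of x - C(x, θ), attained exactly at first-best qualities. The core is
`IsEquilibrium.setIntegral_payoff_le`: in any equilibrium, an upper set A of types earns in total at
most its total maximal surplus, although its single members may earn more. To see this, let a be the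
cutoff of A and choose a monotone step function h of quality, jumping at a quantile m, with E h(q) =
F(A). Incentive compatibility and decreasing differences yield the pointwise bound 1_A Π ≤ 1_A S +
h(q)(P - q) + c(1_A - h(q)), where P is the expected price (`IsCost.indicator_payoff_le`). On
integration the last term vanishes by the choice of h, and the middle one is at most 0 because
prices are conditional expectations of quality (`IsEquilibrium.integral_monotone_mul_le`).
Increasing weights are mixtures of indicators of upper sets, so the layer-cake formula bounds
welfare by ∫ λ S dF. Revealing quality and producing first best attains this bound. Conversely, at
an optimum the slack is zero on almost all superlevel sets of λ. Strict monotonicity turns these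
into all upper rays, so Π = S almost everywhere. Then P(q) - q ≥ 0 has mean zero, hence P(q) = q and
q is first best. Finally, (arctan p - arctan q)(p - q) is nonnegative with integral zero, so the
price itself reveals quality. -/

theorem antitoneOn_of_derivWithin_nonpos {D : Set ℝ} (hD : Convex ℝ D) {f : ℝ → ℝ}
    (hf : DifferentiableOn ℝ f D) (h : ∀ x ∈ D, derivWithin f D x ≤ 0) : AntitoneOn f D := by
  refine antitoneOn_of_deriv_nonpos hD hf.continuousOn (hf.mono interior_subset) fun x hx => ?_
  rw [← derivWithin_of_mem_nhds (mem_interior_iff_mem_nhds.1 hx)]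
  exact h x (interior_subset hx)

theorem monotoneOn_of_derivWithin_nonneg {D : Set ℝ} (hD : Convex ℝ D) {f : ℝ → ℝ}
    (hf : DifferentiableOn ℝ f D) (h : ∀ x ∈ D, 0 ≤ derivWithin f D x) : MonotoneOn f D := by
  refine monotoneOn_of_deriv_nonneg hD hf.continuousOn (hf.mono interior_subset) fun x hx => ?_
  rw [← derivWithin_of_mem_nhds (mem_interior_iff_mem_nhds.1 hx)]
  exact h x (interior_subset hx)

namespace IsCost

variable {C : ℝ → ℝ → ℝ} {θl θh : ℝ}

theorem contDiffOn_quality (hC : IsCost C θl θh) {θ : ℝ} (h : θ ∈ Icc θl θh) :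
    ContDiffOn ℝ 2 (fun x => C x θ) (Ici 0) :=
  hC.smooth.comp (f := fun x : ℝ => (x, θ)) (by fun_prop) fun _ hx => ⟨hx, h⟩

theorem contDiffOn_type (hC : IsCost C θl θh) {x : ℝ} (hx : 0 ≤ x) :
    ContDiffOn ℝ 2 (fun t => C x t) (Icc θl θh) :=
  hC.smooth.comp (f := fun t : ℝ => (x, t)) (by fun_prop) fun _ ht => ⟨hx, ht⟩

theorem differentiableOn_quality (hC : IsCost C θl θh) {θ : ℝ} (h : θ ∈ Icc θl θh) :
    DifferentiableOn ℝ (fun x => C x θ) (Ici 0) :=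
  (hC.contDiffOn_quality h).differentiableOn (by norm_num)

theorem differentiableOn_Cq (hC : IsCost C θl θh) {θ : ℝ} (h : θ ∈ Icc θl θh) :
    DifferentiableOn ℝ (fun x => Cq C x θ) (Ici 0) :=
  ((hC.contDiffOn_quality h).derivWithin (m := 1) (uniqueDiffOn_Ici 0)
    (by norm_num)).differentiableOn (by norm_num)

theorem monotoneOn_Cq (hC : IsCost C θl θh) {θ : ℝ} (h : θ ∈ Icc θl θh) :
    MonotoneOn (fun x => Cq C x θ) (Ici 0) :=
  monotoneOn_of_derivWithin_nonneg (convex_Ici 0) (hC.differentiableOn_Cq h)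
    fun x hx => hC.qq_nonneg x hx θ h

theorem monotoneOn_quality (hC : IsCost C θl θh) {θ : ℝ} (h : θ ∈ Icc θl θh) :
    MonotoneOn (fun x => C x θ) (Ici 0) :=
  monotoneOn_of_derivWithin_nonneg (convex_Ici 0) (hC.differentiableOn_quality h)
    fun x hx => hC.q_nonneg x hx θ h

theorem nonneg (hC : IsCost C θl θh) {x θ : ℝ} (hx : 0 ≤ x) (h : θ ∈ Icc θl θh) :
    0 ≤ C x θ := by
  have := hC.monotoneOn_quality h (mem_Ici.2 le_rfl) (mem_Ici.2 hx) hx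
  simpa [hC.zero θ h] using this

theorem antitoneOn_type (hC : IsCost C θl θh) {x : ℝ} (hx : 0 ≤ x) :
    AntitoneOn (fun t => C x t) (Icc θl θh) :=
  antitoneOn_of_derivWithin_nonpos (convex_Icc _ _)
    ((hC.contDiffOn_type hx).differentiableOn (by norm_num)) fun t ht => hC.θ_nonpos x hx t ht

theorem uniqueDiffOn_domain (hθ : θl < θh) :
    UniqueDiffOn ℝ ((Ici (0 : ℝ)) ×ˢ Icc θl θh) :=
  (uniqueDiffOn_Ici 0).prod (uniqueDiffOn_Icc hθ)

theorem Cq_eq_fderivWithin (hC : IsCost C θl θh) {x θ : ℝ} (hx : 0 ≤ x)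
    (h : θ ∈ Icc θl θh) :
    Cq C x θ =
      fderivWithin ℝ (fun z : ℝ × ℝ => C z.1 z.2) (Ici 0 ×ˢ Icc θl θh) (x, θ) (1, 0) := by
  have h1 : HasFDerivWithinAt (fun z : ℝ × ℝ => C z.1 z.2) _ (Ici 0 ×ˢ Icc θl θh) (x, θ) :=
    (hC.smooth.differentiableOn (by norm_num) (x, θ) ⟨hx, h⟩).hasFDerivWithinAt
  have h2 : HasDerivWithinAt (fun y : ℝ => (y, θ)) ((1 : ℝ), (0 : ℝ)) (Ici 0) x :=
    (hasDerivWithinAt_id x _).prodMk (hasDerivWithinAt_const x _ θ)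
  have h3 : MapsTo (fun y : ℝ => (y, θ)) (Ici 0) (Ici 0 ×ˢ Icc θl θh) := fun y hy => ⟨hy, h⟩
  exact (HasFDerivWithinAt.comp_hasDerivWithinAt x h1 h2 h3).derivWithin
    (uniqueDiffOn_Ici 0 x hx)

theorem antitoneOn_Cq_type (hC : IsCost C θl θh) (hθ : θl < θh) {x : ℝ} (hx : 0 ≤ x) :
    AntitoneOn (fun t => Cq C x t) (Icc θl θh) := by
  refine antitoneOn_of_derivWithin_nonpos (convex_Icc _ _) ?_ fun t ht => hC.qθ_nonpos x hx t ht
  -- The sign condition on the mixed derivative is informative only if C_q is differentiable in the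
  -- type. This follows by writing C_q as the joint derivative, which is C¹, applied to (1, 0).
  have h1 : ContDiffOn ℝ 1 (fderivWithin ℝ (fun z : ℝ × ℝ => C z.1 z.2) (Ici 0 ×ˢ Icc θl θh))
      (Ici 0 ×ˢ Icc θl θh) :=
    hC.smooth.fderivWithin (uniqueDiffOn_domain hθ) (by norm_num)
  have h2 : DifferentiableOn ℝ (fun t => fderivWithin ℝ (fun z : ℝ × ℝ => C z.1 z.2)
      (Ici 0 ×ˢ Icc θl θh) (x, t)) (Icc θl θh) :=
    (h1.differentiableOn (by norm_num)).comp (f := fun t : ℝ => (x, t)) (by fun_prop)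
      fun _ ht => ⟨hx, ht⟩
  exact (h2.clm_apply (differentiableOn_const ((1 : ℝ), (0 : ℝ)))).congr
    fun t ht => hC.Cq_eq_fderivWithin hx ht

/-- Decreasing differences: raising quality costs higher types less. -/
theorem sub_le_sub_type (hC : IsCost C θl θh) (hθ : θl < θh) {x y θ θ' : ℝ} (hx : 0 ≤ x)
    (hxy : x ≤ y) (h : θ ∈ Icc θl θh) (h' : θ' ∈ Icc θl θh) (hle : θ ≤ θ') :
    C y θ' - C x θ' ≤ C y θ - C x θ := by
  have hanti : AntitoneOn ((fun z => C z θ') - fun z => C z θ) (Ici 0) := by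
    refine antitoneOn_of_derivWithin_nonpos (convex_Ici 0)
      ((hC.differentiableOn_quality h').sub (hC.differentiableOn_quality h)) fun z hz => ?_
    rw [derivWithin_sub (hC.differentiableOn_quality h' z hz)
      (hC.differentiableOn_quality h z hz)]
    exact sub_nonpos.2 (hC.antitoneOn_Cq_type hθ hz h h' hle)
  have := hanti (mem_Ici.2 hx) (mem_Ici.2 (hx.trans hxy)) hxy
  simp only [Pi.sub_apply] at this
  linarith

theorem hasDerivWithinAt_surplus (hC : IsCost C θl θh) {x θ : ℝ} (hx : 0 ≤ x)
    (h : θ ∈ Icc θl θh) :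
    HasDerivWithinAt (fun y => y - C y θ) (1 - Cq C x θ) (Ici 0) x :=
  (hasDerivWithinAt_id x _).sub (hC.differentiableOn_quality h x hx).hasDerivWithinAt

theorem antitoneOn_surplus (hC : IsCost C θl θh) {x θ : ℝ} (h : θ ∈ Icc θl θh)
    (hx : IsFirstBest C θ x) : AntitoneOn (fun y => y - C y θ) (Ici x) := by
  have hd : ∀ y ∈ Ici x, HasDerivWithinAt (fun y => y - C y θ) (1 - Cq C y θ) (Ici x) y :=
    fun y hy => (hC.hasDerivWithinAt_surplus (hx.1.trans hy) h).mono (Ici_subset_Ici.2 hx.1)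
  refine antitoneOn_of_derivWithin_nonpos (convex_Ici x)
    (fun y hy => (hd y hy).differentiableWithinAt) fun y hy => ?_
  rw [(hd y hy).derivWithin (uniqueDiffOn_Ici x y hy)]
  have := hC.monotoneOn_Cq h (mem_Ici.2 hx.1) (mem_Ici.2 (hx.1.trans hy)) hy
  simp only [hx.2] at this
  linarith

theorem monotoneOn_surplus (hC : IsCost C θl θh) {x θ : ℝ} (h : θ ∈ Icc θl θh)
    (hx : IsFirstBest C θ x) : MonotoneOn (fun y => y - C y θ) (Icc 0 x) := by
  rcases hx.1.eq_or_lt with h0 | h0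
  · rw [← h0, Icc_self]; exact subsingleton_singleton.monotoneOn _
  have hd : ∀ y ∈ Icc 0 x, HasDerivWithinAt (fun y => y - C y θ) (1 - Cq C y θ) (Icc 0 x) y :=
    fun y hy => (hC.hasDerivWithinAt_surplus hy.1 h).mono Icc_subset_Ici_self
  refine monotoneOn_of_derivWithin_nonneg (convex_Icc 0 x)
    (fun y hy => (hd y hy).differentiableWithinAt) fun y hy => ?_
  rw [(hd y hy).derivWithin (uniqueDiffOn_Icc h0 y hy)]
  have := hC.monotoneOn_Cq h (mem_Ici.2 hy.1) (mem_Ici.2 hx.1) hy.2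
  simp only [hx.2] at this
  linarith

theorem surplus_le_of_isFirstBest (hC : IsCost C θl θh) {x y θ : ℝ} (h : θ ∈ Icc θl θh)
    (hx : IsFirstBest C θ x) (hy : 0 ≤ y) : y - C y θ ≤ x - C x θ := by
  rcases le_total y x with hyx | hxy
  · exact hC.monotoneOn_surplus h hx ⟨hy, hyx⟩ ⟨hx.1, le_rfl⟩ hyx
  · exact hC.antitoneOn_surplus h hx (mem_Ici.2 le_rfl) (mem_Ici.2 hxy) hxy

/-- At an interior maximum the derivative 1 - C_q vanishes. The corner 0 cannot be a maximum,
because C_q(0, θ) = 0 makes the surplus strictly increasing there. -/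
theorem isFirstBest_of_forall_surplus_le (hC : IsCost C θl θh) {x θ : ℝ} (h : θ ∈ Icc θl θh)
    (hx : 0 ≤ x) (hmax : ∀ y, 0 ≤ y → y - C y θ ≤ x - C x θ) : IsFirstBest C θ x := by
  refine ⟨hx, ?_⟩
  have hd := hC.hasDerivWithinAt_surplus hx h
  have hloc : IsLocalMaxOn (fun y => y - C y θ) (Ici 0) x :=
    IsMaxOn.localize fun y hy => hmax y hy
  rcases hx.eq_or_lt with h0 | h0
  · have h1 : (1 : ℝ) ∈ posTangentConeAt (Ici (0 : ℝ)) x := by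
      refine mem_posTangentConeAt_of_segment_subset ?_
      exact (convex_Ici (0 : ℝ)).segment_subset hx (mem_Ici.2 (by linarith))
    have h2 := hloc.hasFDerivWithinAt_nonpos hd.hasFDerivWithinAt h1
    rw [← h0] at h2
    simp [hC.q_zero θ h] at h2
    linarith
  · have hmem : Ici (0 : ℝ) ∈ nhds x := Ici_mem_nhds h0
    have h2 := (hloc.isLocalMax hmem).hasDerivAt_eq_zero (hd.hasDerivAt hmem)
    linarith

end IsCost

/-- The least first-best quality of type `θ`. -/
noncomputable def leastFirstBest (C : ℝ → ℝ → ℝ) (θ : ℝ) : ℝ :=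
  sInf {x | 0 ≤ x ∧ 1 ≤ Cq C x θ}

/-- The surplus `max_x (x - C(x, θ))` of type `θ`. -/
noncomputable def maxSurplus (C : ℝ → ℝ → ℝ) (θ : ℝ) : ℝ :=
  leastFirstBest C θ - C (leastFirstBest C θ) θ

/-! ### First-best selection, maximal surplus and the pointwise payoff bound -/

namespace IsCost

variable {C : ℝ → ℝ → ℝ} {θl θh : ℝ}

theorem isFirstBest_leastFirstBest (hC : IsCost C θl θh) {θ : ℝ} (h : θ ∈ Icc θl θh)
    (hFB : ∃ x, IsFirstBest C θ x) : IsFirstBest C θ (leastFirstBest C θ) := by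
  obtain ⟨x, hx⟩ := hFB
  have hne : ({x | 0 ≤ x ∧ 1 ≤ Cq C x θ} : Set ℝ).Nonempty := ⟨x, hx.1, hx.2.ge⟩
  have hbd : BddBelow {x | 0 ≤ x ∧ 1 ≤ Cq C x θ} := ⟨0, fun _ hy => hy.1⟩
  have hcl : IsClosed {x | 0 ≤ x ∧ 1 ≤ Cq C x θ} :=
    (hC.differentiableOn_Cq h).continuousOn.preimage_isClosed_of_isClosed isClosed_Ici isClosed_Ici
  obtain ⟨h0, h1⟩ := hcl.csInf_mem hne hbd
  refine ⟨h0, le_antisymm ?_ h1⟩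
  have := hC.monotoneOn_Cq h (mem_Ici.2 h0) (mem_Ici.2 hx.1) (csInf_le hbd ⟨hx.1, hx.2.ge⟩)
  simp only [hx.2] at this
  exact this

/-- First-best qualities need not be unique. The least one increases with the type, since C_q ≥ 1 at
a higher type persists at a lower one; monotonicity makes it a measurable, bounded selection. -/
theorem monotoneOn_leastFirstBest (hC : IsCost C θl θh) (hθ : θl < θh)
    (hFB : ∀ θ ∈ Icc θl θh, ∃ x, IsFirstBest C θ x) :
    MonotoneOn (leastFirstBest C) (Icc θl θh) := by
  intro θ h θ' h' hle
  obtain ⟨h0, h1⟩ := hC.isFirstBest_leastFirstBest h' (hFB θ' h')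
  refine csInf_le ⟨0, fun _ hy => hy.1⟩ ⟨h0, ?_⟩
  have := hC.antitoneOn_Cq_type hθ h0 h h' hle
  simp only [h1] at this
  exact this

theorem surplus_le_maxSurplus (hC : IsCost C θl θh) {x θ : ℝ} (h : θ ∈ Icc θl θh)
    (hFB : ∃ x, IsFirstBest C θ x) (hx : 0 ≤ x) : x - C x θ ≤ maxSurplus C θ :=
  hC.surplus_le_of_isFirstBest h (hC.isFirstBest_leastFirstBest h hFB) hx

theorem surplus_eq_maxSurplus_iff (hC : IsCost C θl θh) {x θ : ℝ} (h : θ ∈ Icc θl θh)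
    (hFB : ∃ x, IsFirstBest C θ x) (hx : 0 ≤ x) :
    x - C x θ = maxSurplus C θ ↔ IsFirstBest C θ x := by
  constructor
  · intro he
    exact hC.isFirstBest_of_forall_surplus_le h hx fun y hy =>
      he ▸ hC.surplus_le_maxSurplus h hFB hy
  · intro hx'
    exact le_antisymm (hC.surplus_le_maxSurplus h hFB hx)
      (hC.surplus_le_of_isFirstBest h hx' (hC.isFirstBest_leastFirstBest h hFB).1)

theorem monotoneOn_maxSurplus (hC : IsCost C θl θh)
    (hFB : ∀ θ ∈ Icc θl θh, ∃ x, IsFirstBest C θ x) :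
    MonotoneOn (maxSurplus C) (Icc θl θh) := by
  intro θ h θ' h' hle
  have h0 := (hC.isFirstBest_leastFirstBest h (hFB θ h)).1
  have h1 := hC.antitoneOn_type h0 h h' hle
  have h2 := hC.surplus_le_maxSurplus h' (hFB θ' h') h0
  simp only [maxSurplus] at h1 h2 ⊢
  linarith

/-- If `a` separates the higher from the lower types, `h` is monotone with a jump from `0` to `1`
at `m`, then the payoff of the higher types exceeds maximal surplus by at most a multiple of
`1_A - h` plus the part `h (P - q)` of prices that is redistributed across qualities. -/
theorem indicator_payoff_le (hC : IsCost C θl θh) (hθ : θl < θh)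
    (hFB : ∀ θ ∈ Icc θl θh, ∃ x, IsFirstBest C θ x) {P q : ℝ → ℝ}
    (hq : ∀ θ ∈ Icc θl θh, 0 ≤ q θ)
    (hIC : ∀ θ ∈ Icc θl θh, ∀ x, 0 ≤ x → P x - C x θ ≤ P (q θ) - C (q θ) θ)
    {a m : ℝ} (ha : a ∈ Icc θl θh) (hm : 0 ≤ m) {A : Set ℝ}
    (hA : ∀ θ ∈ Icc θl θh, θ ∈ A → a ≤ θ) (hA' : ∀ θ ∈ Icc θl θh, θ ∉ A → θ ≤ a)
    {h : ℝ → ℝ} (h0 : ∀ x, 0 ≤ h x) (h1 : ∀ x, h x ≤ 1) (hlt : ∀ x, x < m → h x = 0)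
    (hgt : ∀ x, m < x → h x = 1) :
    ∃ c : ℝ, ∀ θ ∈ Icc θl θh,
      A.indicator (fun θ => P (q θ) - C (q θ) θ) θ ≤
        A.indicator (maxSurplus C) θ + h (q θ) * (P (q θ) - q θ) +
          c * (A.indicator 1 θ - h (q θ)) := by
  have hbdd : BddAbove ((fun x => P x - C x a) '' Icc 0 m) :=
    ⟨P (q a) - C (q a) a, by rintro _ ⟨x, hx, rfl⟩; exact hIC a ha x hx.1⟩
  -- The best payoff of the cutoff type a from qualities up to m. Incentive compatibility of a makes
  -- it finite.
  set k := sSup ((fun x => P x - C x a) '' Icc 0 m) with hk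
  have hkle : ∀ x, 0 ≤ x → x ≤ m → P x - C x a ≤ k := fun x hx hxm =>
    le_csSup hbdd ⟨x, ⟨hx, hxm⟩, rfl⟩
  have hxa := hC.isFirstBest_leastFirstBest ha (hFB a ha)
  -- By concavity, this z maximizes the surplus of type a over qualities at least m. The multiplier
  -- c compares k with that surplus.
  set z := max m (leastFirstBest C a) with hz
  have hmz : m ≤ z := le_max_left _ _
  have hxz : leastFirstBest C a ≤ z := le_max_right _ _
  have hsz : ∀ y, m ≤ y → y - C y a ≤ z - C z a := by
    intro y hy
    rcases le_total (leastFirstBest C a) y with hxy | hyx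
    · exact hC.antitoneOn_surplus ha hxa hxz hxy (max_le hy hxy)
    · rw [hz, max_eq_right (hy.trans hyx)]
      exact hC.surplus_le_of_isFirstBest ha hxa (hm.trans hy)
  refine ⟨k - (z - C z a), fun θ hθI => ?_⟩
  have hqθ := hq θ hθI
  by_cases hθA : θ ∈ A
  · simp only [indicator_of_mem hθA, Pi.one_apply]
    have haθ := hA θ hθI hθA
    have hS := hC.surplus_le_maxSurplus hθI (hFB θ hθI) hqθ
    rcases lt_or_ge m (q θ) with hlt' | hge
    · rw [hgt _ hlt']; linarith
    -- The bound is a mixture with weights h and 1 - h. Under h, the surplus of q θ is at most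
    -- maximal. Under 1 - h, decreasing differences between q θ ≤ z carry the bound k from a to θ,
    -- so that the payoff is at most c plus the surplus of θ at z.
    · have h2 := hkle _ hqθ hge
      have h3 := hC.sub_le_sub_type hθ hqθ (hge.trans hmz) ha hθI haθ
      have h4 := hC.surplus_le_maxSurplus hθI (hFB θ hθI) (hm.trans hmz)
      nlinarith [mul_nonneg (sub_nonneg.2 (h1 (q θ))) (sub_nonneg.2 h2), h0 (q θ), h1 (q θ),
        mul_nonneg (sub_nonneg.2 (h1 (q θ))) (sub_nonneg.2 h3),
        mul_nonneg (sub_nonneg.2 (h1 (q θ))) (sub_nonneg.2 h4),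
        mul_nonneg (h0 (q θ)) (sub_nonneg.2 hS)]
  · simp only [indicator_of_notMem hθA]
    have haθ := hA' θ hθI hθA
    rcases lt_or_ge (q θ) m with hlt' | hge
    · rw [hlt _ hlt']; simp
    -- A type below a prefers q θ ≥ m to every quality up to m, so by decreasing differences a does
    -- too. Together with `hsz` this gives P (q θ) - q θ ≥ c.
    · have h2 : k ≤ P (q θ) - C (q θ) a := by
        refine csSup_le ⟨_, 0, ⟨le_rfl, hm⟩, rfl⟩ ?_
        rintro _ ⟨x, hx, rfl⟩
        have h3 := hIC θ hθI x hx.1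
        have h4 := hC.sub_le_sub_type hθ hx.1 (hx.2.trans hge) hθI ha haθ
        simp only
        linarith
      have h3 := hsz _ hge
      nlinarith [mul_nonneg (h0 (q θ)) (sub_nonneg.2 h2), mul_nonneg (h0 (q θ)) (sub_nonneg.2 h3)]

end IsCost

end RatingDesign

/-! ### Quantile step functions -/

namespace RatingDesign

open Filter Topology in
/-- Existence of a monotone step function with a single jump, at a quantile, and a given mean. -/
theorem exists_step_integral_eq {Ω : Type*} [MeasurableSpace Ω] (F : Measure Ω)
    [IsProbabilityMeasure F] {q : Ω → ℝ} (hq : Measurable q) (hq0 : ∀ᵐ ω ∂F, 0 ≤ q ω)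
    {α : ℝ} (hα0 : 0 < α) (hα1 : α ≤ 1) :
    ∃ (m : ℝ) (h : ℝ → ℝ), 0 ≤ m ∧ Monotone h ∧ (∀ x, 0 ≤ h x) ∧ (∀ x, h x ≤ 1) ∧
      (∀ x, x < m → h x = 0) ∧ (∀ x, m < x → h x = 1) ∧ ∫ ω, h (q ω) ∂F = α := by
  set ν := F.map q with hν
  have hprob : IsProbabilityMeasure ν := Measure.isProbabilityMeasure_map hq.aemeasurable
  -- The jump m is the (1 - α)-quantile, taken among nonnegative numbers; α > 0 makes the set
  -- nonempty.
  set T : Set ℝ := {x | 0 ≤ x ∧ 1 - α ≤ cdf ν x} with hT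
  have hne : T.Nonempty := by
    have h1 : ∀ᶠ x in atTop, 1 - α < cdf ν x :=
      (tendsto_cdf_atTop ν).eventually_const_lt (by linarith)
    obtain ⟨x, hx, hx'⟩ := (h1.and (eventually_ge_atTop 0)).exists
    exact ⟨x, hx', hx.le⟩
  have hbd : BddBelow T := ⟨0, fun _ hx => hx.1⟩
  set m := sInf T with hm
  have hm0 : 0 ≤ m := le_csInf hne fun _ hx => hx.1
  have hcm : 1 - α ≤ cdf ν m := by
    have ht : Tendsto (cdf ν) (𝓝[>] m) (𝓝 (cdf ν m)) :=
      ((cdf ν).right_continuous m).mono_left (nhdsWithin_mono _ Ioi_subset_Ici_self)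
    refine ge_of_tendsto ht (eventually_nhdsWithin_of_forall fun y hy => ?_)
    obtain ⟨x, hx, hxy⟩ := exists_lt_of_csInf_lt hne hy
    exact hx.2.trans (monotone_cdf ν hxy.le)
  have hIio : ν.real (Iio m) ≤ 1 - α := by
    rcases hm0.eq_or_lt with h0 | h0
    · have : ν (Iio m) = 0 := by
        rw [← h0, hν, Measure.map_apply hq measurableSet_Iio]
        exact measure_mono_null (fun ω hω => not_le.2 hω) (ae_iff.1 hq0)
      simp only [Measure.real, this, ENNReal.toReal_zero]
      linarith
    · have h1 : Function.leftLim (cdf ν) m ≤ 1 - α := by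
        refine le_of_tendsto ((monotone_cdf ν).tendsto_leftLim m) ?_
        filter_upwards [Ioo_mem_nhdsLT h0] with x hx
        by_contra! hlt
        exact notMem_of_lt_csInf hx.2 hbd ⟨hx.1.le, hlt.le⟩
      have h2 : ν (Iio m) = ENNReal.ofReal (Function.leftLim (cdf ν) m - 0) := by
        rw [← (cdf ν).measure_Iio (tendsto_cdf_atBot ν), measure_cdf]
      have h3 : 0 ≤ Function.leftLim (cdf ν) m :=
        (cdf_nonneg ν (m - 1)).trans ((monotone_cdf ν).le_leftLim (by linarith))
      rw [Measure.real, h2, sub_zero, ENNReal.toReal_ofReal h3]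
      exact h1
  have hIoi : ν.real (Ioi m) ≤ α := by
    have := probReal_compl_eq_one_sub (μ := ν) (measurableSet_Iic (a := m))
    rw [compl_Iic] at this
    rw [this, ← cdf_eq_real]
    linarith
  have hIci : α ≤ ν.real (Ioi m) + ν.real {m} := by
    have h1 := probReal_compl_eq_one_sub (μ := ν) (measurableSet_Iio (a := m))
    rw [compl_Iio, ← Ioi_union_left, measureReal_union (by simp) (measurableSet_singleton m)] at h1
    linarith
  -- The value at the jump splits a possible atom of the quality distribution so that the mean is
  -- exactly α. Without an atom the quotient is 0, and the mass above m is already α.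
  set c := (α - ν.real (Ioi m)) / ν.real {m} with hc
  have hb : 0 ≤ ν.real {m} := measureReal_nonneg
  have hc0 : 0 ≤ c := div_nonneg (by linarith) hb
  have hc1 : c ≤ 1 := div_le_one_of_le₀ (by linarith) hb
  have hcb : c * ν.real {m} = α - ν.real (Ioi m) := by
    rcases hb.eq_or_lt with h0 | h0
    · rw [← h0] at hIci ⊢; linarith
    · exact div_mul_cancel₀ _ h0.ne'
  set h : ℝ → ℝ := fun x => (Ioi m).indicator 1 x + c * ({m} : Set ℝ).indicator 1 x with hh
  have hlt : ∀ x, x < m → h x = 0 := fun x hx => by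
    simp [hh, indicator, hx.ne, hx.le]
  have hgt : ∀ x, m < x → h x = 1 := fun x hx => by
    simp [hh, indicator, hx.ne', hx]
  have heq : h m = c := by simp [hh]
  have h0 : ∀ x, 0 ≤ h x := fun x => by
    rcases lt_trichotomy x m with hx | rfl | hx
    · rw [hlt x hx]
    · rwa [heq]
    · rw [hgt x hx]; exact zero_le_one
  have h1 : ∀ x, h x ≤ 1 := fun x => by
    rcases lt_trichotomy x m with hx | rfl | hx
    · rw [hlt x hx]; exact zero_le_one
    · rwa [heq]
    · rw [hgt x hx]
  have hmono : Monotone h := fun x y hxy => by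
    rcases lt_or_ge x m with hx | hx
    · rw [hlt x hx]; exact h0 y
    · rcases hxy.eq_or_lt with rfl | hlt'
      · rfl
      · rw [hgt y (hx.trans_lt hlt')]; exact h1 x
  refine ⟨m, h, hm0, hmono, h0, h1, hlt, hgt, ?_⟩
  rw [← integral_map (f := h) hq.aemeasurable hmono.measurable.aestronglyMeasurable,
    ← hν, hh, integral_add, integral_const_mul, integral_indicator_one measurableSet_Ioi,
    integral_indicator_one (measurableSet_singleton m), hcb]
  · ring
  · exact (integrable_const (1 : ℝ)).indicator measurableSet_Ioi
  · exact ((integrable_const (1 : ℝ)).indicator (measurableSet_singleton m)).const_mul c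

instance isProbabilityMeasure_jointLaw {F : Measure ℝ} [IsProbabilityMeasure F]
    {R : RatingSystem} {q : ℝ → ℝ} (hq : Measurable q) :
    IsProbabilityMeasure (jointLaw F R q hq) := by
  unfold jointLaw; infer_instance

theorem IsAllocation.integrable_quality {θl θh : ℝ} {F : Measure ℝ} [IsProbabilityMeasure F]
    {R : RatingSystem} {q : ℝ → ℝ} (hq : IsAllocation θl θh F q) :
    Integrable (fun z => q z.1) (jointLaw F R q hq.measurable) := by
  have h : (jointLaw F R q hq.measurable).map Prod.fst = F := Measure.fst_compProd F _
  exact Integrable.comp_measurable (g := q) (by rw [h]; exact hq.integrable) measurable_fst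

/-! ### Prices as conditional expectations -/

namespace IsEquilibrium

variable {C : ℝ → ℝ → ℝ} {θl θh : ℝ} {F : Measure ℝ}
  {R : RatingSystem} {q : ℝ → ℝ} {p : R.Signal → ℝ}

theorem measurable_quality (E : IsEquilibrium C θl θh F R q p) : Measurable q :=
  E.allocation.measurable

theorem integrable_quality [IsProbabilityMeasure F] (E : IsEquilibrium C θl θh F R q p) :
    Integrable (fun z => q z.1) (jointLaw F R q E.measurable_quality) :=
  E.allocation.integrable_quality

theorem integrable_price (E : IsEquilibrium C θl θh F R q p) :
    Integrable (fun z => p z.2) (jointLaw F R q E.measurable_quality) :=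
  integrable_condExp.congr E.price_eq.symm

theorem integrable_expectedPrice [IsProbabilityMeasure F] (E : IsEquilibrium C θl θh F R q p) :
    Integrable (fun θ => expectedPrice R p (q θ)) F :=
  Integrable.integral_compProd (f := fun z : ℝ × R.Signal => p z.2) E.integrable_price

/-- Price errors are uncorrelated with functions of the price. -/
theorem integral_mul_sub_eq_zero [IsProbabilityMeasure F] (E : IsEquilibrium C θl θh F R q p) {u : ℝ → ℝ}
    (hu : Measurable u) {b : ℝ} (hb : ∀ x, |u x| ≤ b) :
    ∫ z, u (p z.2) * (p z.2 - q z.1) ∂(jointLaw F R q E.measurable_quality) = 0 := by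
  set μ := jointLaw F R q E.measurable_quality
  have hup' : AEStronglyMeasurable (fun z : ℝ × R.Signal => u (p z.2)) μ :=
    (hu.comp (E.price_measurable.comp measurable_snd)).aestronglyMeasurable
  have hi1 : Integrable (fun z : ℝ × R.Signal => u (p z.2) * q z.1) μ :=
    E.integrable_quality.bdd_mul hup' (ae_of_all _ fun z => hb _)
  have hi2 : Integrable (fun z : ℝ × R.Signal => u (p z.2) * p z.2) μ :=
    E.integrable_price.bdd_mul hup' (ae_of_all _ fun z => hb _)
  set m := MeasurableSpace.comap (Prod.snd : ℝ × R.Signal → R.Signal) R.measurableSpace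
  have hm : m ≤ Prod.instMeasurableSpace := measurable_snd.comap_le
  have hup : StronglyMeasurable[m] fun z : ℝ × R.Signal => u (p z.2) :=
    ((hu.comp E.price_measurable).comp (comap_measurable Prod.snd)).stronglyMeasurable
  simp only [mul_sub]
  rw [integral_sub hi2 hi1, sub_eq_zero]
  have h1 : μ[fun z => u (p z.2) * q z.1 | m] =ᵐ[μ] fun z => u (p z.2) * p z.2 := by
    refine (condExp_mul_of_stronglyMeasurable_left hup hi1 E.integrable_quality).trans ?_
    filter_upwards [E.price_eq] with z hz
    exact congrArg (u (p z.2) * ·) hz.symm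
  rw [← integral_congr_ae h1, integral_condExp hm]

theorem integrable_mul_sub [IsProbabilityMeasure F] (E : IsEquilibrium C θl θh F R q p) {u : ℝ → ℝ}
    (hu : Measurable u) {b : ℝ} (hb : ∀ x, |u x| ≤ b) :
    Integrable (fun z => u (q z.1) * (p z.2 - q z.1))
      (jointLaw F R q E.measurable_quality) :=
  (E.integrable_price.sub E.integrable_quality).bdd_mul
    (hu.comp (E.measurable_quality.comp measurable_fst)).aestronglyMeasurable
    (ae_of_all _ fun _ => hb _)

theorem integrable_mul_sub_price [IsProbabilityMeasure F] (E : IsEquilibrium C θl θh F R q p) {u : ℝ → ℝ}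
    (hu : Measurable u) {b : ℝ} (hb : ∀ x, |u x| ≤ b) :
    Integrable (fun z => u (p z.2) * (p z.2 - q z.1))
      (jointLaw F R q E.measurable_quality) :=
  (E.integrable_price.sub E.integrable_quality).bdd_mul
    (hu.comp (E.price_measurable.comp measurable_snd)).aestronglyMeasurable
    (ae_of_all _ fun _ => hb _)

theorem ae_mem_Icc (hF : F (Icc θl θh)ᶜ = 0) : ∀ᵐ θ ∂F, θ ∈ Icc θl θh := hF

theorem integral_expectedPrice_sub [IsProbabilityMeasure F] (E : IsEquilibrium C θl θh F R q p)
    (hF : F (Icc θl θh)ᶜ = 0) {u : ℝ → ℝ} (hu : Measurable u) {b : ℝ} (hb : ∀ x, |u x| ≤ b) :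
    ∫ z, u (q z.1) * (p z.2 - q z.1) ∂(jointLaw F R q E.measurable_quality) =
      ∫ θ, u (q θ) * (expectedPrice R p (q θ) - q θ) ∂F := by
  have h := E.integrable_mul_sub hu hb
  unfold jointLaw at h ⊢
  rw [Measure.integral_compProd h]
  refine integral_congr_ae ?_
  filter_upwards [ae_mem_Icc hF] with θ hθ
  have hp := E.price_integrable (q θ) (E.allocation.nonneg θ hθ)
  simp only [Kernel.comap_apply]
  rw [integral_const_mul, integral_sub hp (integrable_const _)]
  simp [expectedPrice]

/-- Conditional expectation contracts: expected prices are less dispersed than qualities. -/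
theorem integral_monotone_mul_le [IsProbabilityMeasure F] (E : IsEquilibrium C θl θh F R q p)
    (hF : F (Icc θl θh)ᶜ = 0) {h : ℝ → ℝ} (hh : Monotone h) {b : ℝ} (hb : ∀ x, |h x| ≤ b) :
    ∫ θ, h (q θ) * (expectedPrice R p (q θ) - q θ) ∂F ≤ 0 := by
  rw [← E.integral_expectedPrice_sub hF hh.measurable hb,
    ← E.integral_mul_sub_eq_zero hh.measurable hb]
  -- Replacing h(q) by h(p) can only raise the integral, since (h(p) - h(q))(p - q) ≥ 0; with h(p)
  -- it is zero.
  refine integral_mono (E.integrable_mul_sub hh.measurable hb)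
    (E.integrable_mul_sub_price hh.measurable hb) fun z => ?_
  simp only
  rcases le_total (p z.2) (q z.1) with hle | hle
  · nlinarith [hh hle]
  · nlinarith [hh hle]

/-- If expected prices equal quality, the price reveals quality. -/
theorem price_eq_quality [IsProbabilityMeasure F] (E : IsEquilibrium C θl θh F R q p) (hF : F (Icc θl θh)ᶜ = 0)
    (hP : ∀ᵐ θ ∂F, expectedPrice R p (q θ) = q θ) :
    ∀ᵐ θ ∂F, ∀ᵐ s ∂(R.rating (q θ)), p s = q θ := by
  -- Any bounded strictly increasing function would do: boundedness gives integrability when q is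
  -- merely integrable, and strictness forces p = q.
  have hmeas : Measurable Real.arctan := Real.continuous_arctan.measurable
  have hb : ∀ x, |Real.arctan x| ≤ Real.pi / 2 := fun x =>
    abs_le.2 ⟨(Real.neg_pi_div_two_lt_arctan x).le, (Real.arctan_lt_pi_div_two x).le⟩
  have i1 := E.integrable_mul_sub hmeas hb
  have i2 := E.integrable_mul_sub_price hmeas hb
  have h1 := E.integral_mul_sub_eq_zero hmeas hb
  have h2 : ∫ z, Real.arctan (q z.1) * (p z.2 - q z.1)
      ∂(jointLaw F R q E.measurable_quality) = 0 := by
    rw [E.integral_expectedPrice_sub hF hmeas hb]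
    refine integral_eq_zero_of_ae ?_
    filter_upwards [hP] with θ hθ
    simp [hθ]
  have h3 := integral_sub' i2 i1
  rw [h1, h2, sub_zero, integral_eq_zero_iff_of_nonneg _ (i2.sub i1)] at h3
  · have h4 : ∀ᵐ z ∂(F ⊗ₘ (R.rating.comap q E.measurable_quality)), p z.2 = q z.1 := by
      filter_upwards [h3] with z hz
      simp only [Pi.sub_apply, Pi.zero_apply, ← sub_mul] at hz
      rcases mul_eq_zero.1 hz with hz | hz
      · exact Real.arctan_injective (sub_eq_zero.1 hz)
      · exact sub_eq_zero.1 hz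
    simpa [Kernel.comap_apply] using Measure.ae_ae_of_ae_compProd h4
  · intro z
    simp only [Pi.sub_apply, Pi.zero_apply]
    rcases le_total (p z.2) (q z.1) with hle | hle
    · nlinarith [Real.arctan_strictMono.monotone hle]
    · nlinarith [Real.arctan_strictMono.monotone hle]

end IsEquilibrium

end RatingDesign

/-! ### Layer-cake formula and superlevel sets -/

namespace RatingDesign

theorem layer_integrable {Ω : Type*} [MeasurableSpace Ω] {F : Measure Ω} [SFinite F]
    {L g : Ω → ℝ} (hL : Measurable L) (hg : Integrable g F) (M : ℝ) :
    Integrable (Function.uncurry fun ω t => (Iio (L ω)).indicator (1 : ℝ → ℝ) t * g ω)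
      (F.prod (volume.restrict (Ico 0 M))) := by
  have h1 : MeasurableSet {z : Ω × ℝ | z.2 < L z.1} :=
    measurableSet_lt measurable_snd (hL.comp measurable_fst)
  have h2 : (Function.uncurry fun ω t => (Iio (L ω)).indicator (1 : ℝ → ℝ) t * g ω) =
      {z : Ω × ℝ | z.2 < L z.1}.indicator fun z => g z.1 := by
    ext ⟨ω, t⟩
    simp [indicator_apply]
  rw [h2]
  exact (hg.comp_fst _).indicator h1

theorem layer_integral_eq {Ω : Type*} [MeasurableSpace Ω] {F : Measure Ω}
    {L : Ω → ℝ} (hL : Measurable L) (g : Ω → ℝ) (t : ℝ) :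
    ∫ ω, (Iio (L ω)).indicator (1 : ℝ → ℝ) t * g ω ∂F = ∫ ω in {ω | t < L ω}, g ω ∂F := by
  rw [← integral_indicator (measurableSet_lt measurable_const hL)]
  congr 1 with ω
  simp [indicator_apply]

/-- A weighted integral is the integral over the level `t` of the integrals over `{t < L}`. -/
theorem integral_mul_eq_integral_superlevel {Ω : Type*} [MeasurableSpace Ω] {F : Measure Ω}
    [SFinite F] {L g : Ω → ℝ} (hL : Measurable L) (hg : Integrable g F) {M : ℝ}
    (h0 : ∀ ω, 0 ≤ L ω) (hM : ∀ ω, L ω ≤ M) :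
    ∫ ω, L ω * g ω ∂F = ∫ t in Ico 0 M, ∫ ω in {ω | t < L ω}, g ω ∂F := by
  have h := integral_integral_swap (layer_integrable hL hg M)
  simp only [layer_integral_eq hL] at h
  rw [← h]
  congr 1 with ω
  rw [integral_mul_const, integral_indicator_one measurableSet_Iio,
    measureReal_restrict_apply measurableSet_Iio]
  have : Iio (L ω) ∩ Ico 0 M = Ico 0 (L ω) := by
    ext t
    simp only [mem_inter_iff, mem_Iio, mem_Ico]
    exact ⟨fun h => ⟨h.2.1, h.1⟩, fun h => ⟨h.2, h.1, h.2.trans_le (hM ω)⟩⟩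
  rw [this, Real.volume_real_Ico_of_le (h0 ω), sub_zero]

theorem integrableOn_integral_superlevel {Ω : Type*} [MeasurableSpace Ω] {F : Measure Ω}
    [SFinite F] {L g : Ω → ℝ} (hL : Measurable L) (hg : Integrable g F) (M : ℝ) :
    IntegrableOn (fun t => ∫ ω in {ω | t < L ω}, g ω ∂F) (Ico 0 M) := by
  have h := (layer_integrable hL hg M).integral_prod_right
  simp only [Function.uncurry_apply_pair, layer_integral_eq hL] at h
  exact h

/-- The upper rays form a π-system generating the Borel sets, so vanishing integrals extend to all
measurable sets. -/
theorem ae_eq_zero_of_forall_setIntegral_Ioi {F : Measure ℝ} {g : ℝ → ℝ}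
    (hg : Integrable g F) (h0 : ∫ θ, g θ ∂F = 0) (h : ∀ a, ∫ θ in Ioi a, g θ ∂F = 0) :
    g =ᵐ[F] 0 := by
  refine hg.ae_eq_zero_of_forall_setIntegral_eq_zero fun s hs _ => ?_
  refine MeasurableSpace.induction_on_inter (C := fun s _ => ∫ θ in s, g θ ∂F = 0)
    ((BorelSpace.measurable_eq (α := ℝ)).trans (borel_eq_generateFrom_Ioi ℝ)) isPiSystem_Ioi
    (by simp) ?_ ?_ ?_ s hs
  · rintro _ ⟨a, rfl⟩
    exact h a
  · intro t ht hz
    rw [setIntegral_compl ht hg, h0, hz, sub_zero]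
  · intro f hd hf hz
    have := hasSum_integral_iUnion hf hd hg.integrableOn
    simp only [hz] at this
    exact this.unique hasSum_zero

open Filter Topology in
/-- If the integrals of `g` over almost all superlevel sets of a strictly increasing function
vanish, so does `g`. -/
theorem ae_eq_zero_of_superlevel {θl θh : ℝ} {F : Measure ℝ}
    (hF_cont : ∀ θ, F {θ} = 0) (hF : F (Icc θl θh)ᶜ = 0) {L g : ℝ → ℝ} (hL : Measurable L)
    (hg : Integrable g F) (hL0 : ∀ θ ∈ Icc θl θh, 0 ≤ L θ) (hmono : StrictMonoOn L (Icc θl θh))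
    (h : ∀ᵐ t ∂(volume.restrict (Ico 0 (L θh))), ∫ θ in {θ | t < L θ}, g θ ∂F = 0) :
    g =ᵐ[F] 0 := by
  have hae : ∀ᵐ θ ∂F, θ ∈ Icc θl θh := hF
  have key : ∀ a, θl ≤ a → a < θh → ∫ θ in Ioi a, g θ ∂F = 0 := by
    intro a ha hah
    have haI : a ∈ Icc θl θh := ⟨ha, hah.le⟩
    have hhI : θh ∈ Icc θl θh := ⟨ha.trans hah.le, le_rfl⟩
    obtain ⟨b, -, hb, hblim⟩ := exists_seq_strictAnti_tendsto' hah
    have hbI : ∀ n, b n ∈ Icc θl θh := fun n => ⟨ha.trans (hb n).1.le, (hb n).2.le⟩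
    -- Strict monotonicity gives the interval of levels positive length, so it contains a good level
    -- even if L is discontinuous. The superlevel set then lies between the types from b n upwards
    -- and those above a; as b n decreases to a, it tends to the upper ray.
    have hex : ∀ n, ∃ t ∈ Ioo (L a) (L (b n)), ∫ θ in {θ | t < L θ}, g θ ∂F = 0 := by
      intro n
      have hsub : Ioo (L a) (L (b n)) ⊆ Ico 0 (L θh) := fun t ht =>
        ⟨(hL0 a haI).trans ht.1.le, ht.2.trans (hmono (hbI n) hhI (hb n).2)⟩
      have h' : ∀ᵐ t ∂(volume.restrict (Ioo (L a) (L (b n)))),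
          t ∈ Ioo (L a) (L (b n)) ∧ ∫ θ in {θ | t < L θ}, g θ ∂F = 0 :=
        (ae_restrict_mem measurableSet_Ioo).and (ae_restrict_of_ae_restrict_of_subset hsub h)
      have hne : (volume.restrict (Ioo (L a) (L (b n)))) ≠ 0 := by
        rw [Ne, Measure.restrict_eq_zero, Real.volume_Ioo, ENNReal.ofReal_eq_zero, not_le, sub_pos]
        exact hmono haI (hbI n) (hb n).1
      have := ae_neBot.2 hne
      obtain ⟨t, ht⟩ := h'.exists
      exact ⟨t, ht⟩
    choose t ht hz using hex
    have hlim : Tendsto (fun n => ∫ θ, {θ | t n < L θ}.indicator g θ ∂F) atTop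
        (𝓝 (∫ θ, (Ioi a).indicator g θ ∂F)) := by
      refine tendsto_integral_of_dominated_convergence (fun θ => ‖g θ‖) (fun n => ?_) hg.norm
        (fun n => ae_of_all _ fun θ => norm_indicator_le_norm_self _ _) ?_
      · exact (hg.indicator (measurableSet_lt measurable_const hL)).aestronglyMeasurable
      · filter_upwards [hae] with θ hθ
        refine tendsto_const_nhds.congr' ?_
        rcases le_or_gt θ a with hle | hlt
        · refine Eventually.of_forall fun n => ?_
          have : ¬ t n < L θ := not_lt.2 ((hmono.monotoneOn hθ haI hle).trans (ht n).1.le)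
          simp [this, hle]
        · filter_upwards [hblim.eventually_lt_const hlt] with n hn
          have : t n < L θ := (ht n).2.trans (hmono (hbI n) hθ hn)
          simp [this, hlt]
    simp only [integral_indicator (measurableSet_lt measurable_const hL), hz,
      integral_indicator measurableSet_Ioi] at hlim
    exact tendsto_nhds_unique hlim tendsto_const_nhds
  have hhigh : ∀ a, θh ≤ a → ∫ θ in Ioi a, g θ ∂F = 0 := by
    intro a ha
    refine setIntegral_measure_zero _ (measure_mono_null (fun θ hθ => ?_) hF)
    exact fun hI => absurd (hI.2.trans ha) (not_le.2 hθ)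
  have hl : ∫ θ in Ioi θl, g θ ∂F = 0 := by
    rcases lt_or_ge θl θh with hlt | hge
    · exact key θl le_rfl hlt
    · exact hhigh θl hge
  have hfull : ∀ s, Ioi θl ⊆ s → ∫ θ in s, g θ ∂F = 0 := by
    intro s hs
    rw [← hl]
    refine setIntegral_congr_set ?_
    -- Atomlessness is needed only here: levels above L θl never detect the lowest type.
    have hne : ∀ᵐ θ ∂F, θ ≠ θl := by simpa [ae_iff] using hF_cont θl
    filter_upwards [hae, hne] with θ h1 h2
    have : θ ∈ Ioi θl := lt_of_le_of_ne h1.1 h2.symm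
    exact propext ⟨fun _ => this, fun _ => hs this⟩
  refine ae_eq_zero_of_forall_setIntegral_Ioi hg ?_ fun a => ?_
  · rw [← setIntegral_univ]; exact hfull _ (subset_univ _)
  · rcases lt_or_ge a θl with h1 | h1
    · exact hfull _ (Ioi_subset_Ioi h1.le)
    · rcases lt_or_ge a θh with h2 | h2
      · exact key a h1 h2
      · exact hhigh a h2

end RatingDesign

/-! ### The welfare bound, its attainment and the equality case -/

namespace RatingDesign

/-- The projection to the type space `[θl, θh]`. -/
def clamp (θl θh t : ℝ) : ℝ := max θl (min t θh)

theorem clamp_mem {θl θh : ℝ} (hθ : θl < θh) (t : ℝ) : clamp θl θh t ∈ Icc θl θh :=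
  ⟨le_max_left _ _, max_le hθ.le (min_le_right _ _)⟩

theorem clamp_of_mem {θl θh t : ℝ} (ht : t ∈ Icc θl θh) : clamp θl θh t = t := by
  rw [clamp, min_eq_left ht.2, max_eq_right ht.1]

theorem monotone_clamp (θl θh : ℝ) : Monotone (clamp θl θh) := fun _ _ h =>
  max_le_max le_rfl (min_le_min h le_rfl)

theorem continuous_clamp (θl θh : ℝ) : Continuous (clamp θl θh) := by
  unfold clamp; fun_prop

theorem monotone_comp_clamp {θl θh : ℝ} (hθ : θl < θh) {f : ℝ → ℝ}
    (hf : MonotoneOn f (Icc θl θh)) : Monotone fun t => f (clamp θl θh t) := fun s t hst =>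
  hf (clamp_mem hθ s) (clamp_mem hθ t) (monotone_clamp θl θh hst)

theorem ae_comp_clamp {θl θh : ℝ} {F : Measure ℝ} (hF : F (Icc θl θh)ᶜ = 0) (f : ℝ → ℝ) :
    (fun t => f (clamp θl θh t)) =ᵐ[F] f := by
  filter_upwards [(hF : ∀ᵐ θ ∂F, θ ∈ Icc θl θh)] with θ h
  rw [clamp_of_mem h]

theorem integrable_of_monotoneOn {θl θh : ℝ} (hθ : θl < θh) {F : Measure ℝ}
    [IsProbabilityMeasure F] (hF : F (Icc θl θh)ᶜ = 0) {f : ℝ → ℝ}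
    (hf : MonotoneOn f (Icc θl θh)) : Integrable f F := by
  refine Integrable.congr ?_ (ae_comp_clamp hF f)
  refine Integrable.of_bound (monotone_comp_clamp hθ hf).measurable.aestronglyMeasurable
    (max |f θl| |f θh|) (ae_of_all _ fun t => ?_)
  have h := clamp_mem hθ t
  exact abs_le_max_abs_abs (hf ⟨le_rfl, hθ.le⟩ h h.1) (hf h ⟨hθ.le, le_rfl⟩ h.2)

theorem IsCost.integrable_maxSurplus {C : ℝ → ℝ → ℝ} {θl θh : ℝ} (hC : IsCost C θl θh)
    (hθ : θl < θh) (hFB : ∀ θ ∈ Icc θl θh, ∃ x, IsFirstBest C θ x) {F : Measure ℝ}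
    [IsProbabilityMeasure F] (hF : F (Icc θl θh)ᶜ = 0) : Integrable (maxSurplus C) F :=
  integrable_of_monotoneOn hθ hF (hC.monotoneOn_maxSurplus hFB)

theorem IsCost.aestronglyMeasurable_comp {C : ℝ → ℝ → ℝ} {θl θh : ℝ} (hC : IsCost C θl θh)
    (hθ : θl < θh) {F : Measure ℝ} (hF : F (Icc θl θh)ᶜ = 0) {q : ℝ → ℝ}
    (hq : IsAllocation θl θh F q) : AEStronglyMeasurable (fun θ => C (q θ) θ) F := by
  have h1 : Continuous fun z : ℝ × ℝ => C (max 0 z.1) (clamp θl θh z.2) :=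
    hC.smooth.continuousOn.comp_continuous
      (f := fun z : ℝ × ℝ => (max 0 z.1, clamp θl θh z.2))
      ((continuous_const.max continuous_fst).prodMk ((continuous_clamp θl θh).comp continuous_snd))
      fun z => ⟨le_max_left 0 z.1, clamp_mem hθ z.2⟩
  have h2 : Measurable fun θ => C (max 0 (q θ)) (clamp θl θh θ) :=
    h1.measurable.comp (hq.measurable.prodMk measurable_id)
  refine h2.aestronglyMeasurable.congr ?_
  filter_upwards [(hF : ∀ᵐ θ ∂F, θ ∈ Icc θl θh)] with θ h
  rw [clamp_of_mem h, max_eq_right (hq.nonneg θ h)]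

namespace IsEquilibrium

variable {C : ℝ → ℝ → ℝ} {θl θh : ℝ} {F : Measure ℝ} {R : RatingSystem} {q : ℝ → ℝ}
  {p : R.Signal → ℝ}

theorem integrable_payoff [IsProbabilityMeasure F] (E : IsEquilibrium C θl θh F R q p)
    (hC : IsCost C θl θh) (hθ : θl < θh) (hF : F (Icc θl θh)ᶜ = 0) :
    Integrable (fun θ => payoff C R p (q θ) θ) F := by
  refine E.integrable_expectedPrice.sub ?_
  -- Participation bounds the cost by the expected price, which is integrable.
  refine E.integrable_expectedPrice.mono' (hC.aestronglyMeasurable_comp hθ hF E.allocation) ?_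
  filter_upwards [(hF : ∀ᵐ θ ∂F, θ ∈ Icc θl θh)] with θ h
  have h1 := E.participation θ h
  rw [Real.norm_eq_abs, abs_of_nonneg (hC.nonneg (E.allocation.nonneg θ h) h)]
  exact sub_nonneg.1 h1

/-- Any upper set of types earns at most its maximal surplus. -/
theorem setIntegral_payoff_le [IsProbabilityMeasure F] (E : IsEquilibrium C θl θh F R q p)
    (hC : IsCost C θl θh) (hθ : θl < θh) (hFB : ∀ θ ∈ Icc θl θh, ∃ x, IsFirstBest C θ x)
    (hF : F (Icc θl θh)ᶜ = 0) {A : Set ℝ} (hA : MeasurableSet A) (hup : IsUpperSet A) :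
    ∫ θ in A, payoff C R p (q θ) θ ∂F ≤ ∫ θ in A, maxSurplus C θ ∂F := by
  have hae : ∀ᵐ θ ∂F, θ ∈ Icc θl θh := hF
  rcases (measureReal_nonneg (μ := F) (s := A)).eq_or_lt with hz | hpos
  · have hz' : F A = 0 := (measureReal_eq_zero_iff).1 hz.symm
    rw [setIntegral_measure_zero _ hz', setIntegral_measure_zero _ hz']
  -- The cutoff is the infimum of A within the type space; whether it belongs to A is immaterial.
  have hsep : ∃ a ∈ Icc θl θh, (∀ θ ∈ Icc θl θh, θ ∈ A → a ≤ θ) ∧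
      ∀ θ ∈ Icc θl θh, θ ∉ A → θ ≤ a := by
    rcases (A ∩ Icc θl θh).eq_empty_or_nonempty with he | hne
    · exact ⟨θh, ⟨hθ.le, le_rfl⟩, fun θ h hAθ => (eq_empty_iff_forall_notMem.1 he θ ⟨hAθ, h⟩).elim, fun θ h _ => h.2⟩
    · have hbd : BddBelow (A ∩ Icc θl θh) := ⟨θl, fun θ h => h.2.1⟩
      obtain ⟨b, hb⟩ := hne
      refine ⟨sInf (A ∩ Icc θl θh), ⟨le_csInf ⟨b, hb⟩ fun θ h => h.2.1,
        (csInf_le hbd hb).trans hb.2.2⟩, fun θ h hAθ => csInf_le hbd ⟨hAθ, h⟩, fun θ h hAθ => ?_⟩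
      refine le_csInf ⟨b, hb⟩ fun θ' h' => ?_
      by_contra! hlt
      exact hAθ (hup hlt.le h'.1)
  obtain ⟨a, ha, hA1, hA2⟩ := hsep
  have hq0 : ∀ᵐ θ ∂F, 0 ≤ q θ := hae.mono fun θ h => E.allocation.nonneg θ h
  obtain ⟨m, h, hm, hmono, h0, h1, hlt, hgt, hint⟩ :=
    exists_step_integral_eq F E.measurable_quality hq0 hpos measureReal_le_one
  obtain ⟨c, hc⟩ := hC.indicator_payoff_le hθ hFB (P := expectedPrice R p)
    E.allocation.nonneg E.incentive ha hm hA1 hA2 h0 h1 hlt hgt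
  have hb : ∀ x, |h x| ≤ 1 := fun x => by rw [abs_of_nonneg (h0 x)]; exact h1 x
  have hhq : AEStronglyMeasurable (fun θ => h (q θ)) F :=
    (hmono.measurable.comp E.measurable_quality).aestronglyMeasurable
  have i1 : Integrable (A.indicator (maxSurplus C)) F :=
    (hC.integrable_maxSurplus hθ hFB hF).indicator hA
  have i2 : Integrable (fun θ => h (q θ) * (expectedPrice R p (q θ) - q θ)) F :=
    (E.integrable_expectedPrice.sub E.allocation.integrable).bdd_mul hhq (ae_of_all _ fun _ => hb _)
  have i3 : Integrable (A.indicator (1 : ℝ → ℝ)) F :=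
    (integrable_const (1 : ℝ)).indicator hA
  have i4 : Integrable (fun θ => h (q θ)) F :=
    Integrable.of_bound hhq 1 (ae_of_all _ fun _ => hb _)
  have i5 : Integrable (fun θ => c * (A.indicator 1 θ - h (q θ))) F := (i3.sub i4).const_mul c
  rw [← integral_indicator hA, ← integral_indicator hA]
  calc ∫ θ, A.indicator (fun θ => payoff C R p (q θ) θ) θ ∂F
      ≤ ∫ θ, (A.indicator (maxSurplus C) θ + h (q θ) * (expectedPrice R p (q θ) - q θ) +
          c * (A.indicator 1 θ - h (q θ))) ∂F :=
        integral_mono_ae ((E.integrable_payoff hC hθ hF).indicator hA) ((i1.add i2).add i5)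
          (hae.mono fun θ hθI => hc θ hθI)
    _ = ∫ θ, A.indicator (maxSurplus C) θ ∂F +
          ∫ θ, h (q θ) * (expectedPrice R p (q θ) - q θ) ∂F := by
        rw [integral_add (f := fun θ => A.indicator (maxSurplus C) θ +
            h (q θ) * (expectedPrice R p (q θ) - q θ)) (i1.add i2) i5, integral_add i1 i2, integral_const_mul,
          integral_sub i3 i4, hint, integral_indicator_one hA, sub_self, mul_zero, add_zero]
    _ ≤ ∫ θ, A.indicator (maxSurplus C) θ ∂F := by
        linarith [E.integral_monotone_mul_le hF hmono hb]

end IsEquilibrium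

/-- The rating system that reveals quality. -/
noncomputable abbrev revealing : RatingSystem where
  Signal := ℝ
  rating := Kernel.id

theorem expectedPrice_revealing {x : ℝ} (hx : 0 ≤ x) :
    expectedPrice revealing (fun s : ℝ => max s 0) x = x := by
  have h : ∫ s : ℝ, max s 0 ∂((Kernel.id : Kernel ℝ ℝ) x) = x := by
    rw [Kernel.id_apply, integral_dirac, max_eq_left hx]
  exact h

theorem isEquilibrium_revealing {C : ℝ → ℝ → ℝ} {θl θh : ℝ} (hC : IsCost C θl θh)
    {F : Measure ℝ} [IsProbabilityMeasure F] (hF : F (Icc θl θh)ᶜ = 0) {q : ℝ → ℝ}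
    (hq : IsAllocation θl θh F q) (hqFB : ∀ θ ∈ Icc θl θh, IsFirstBest C θ (q θ)) :
    IsEquilibrium C θl θh F revealing q (fun s : ℝ => max s 0) := by
  have hpm : Measurable fun s : ℝ => max s 0 := measurable_id.max measurable_const
  refine ⟨hq, hpm, fun s => le_max_right _ _, fun x _ => ?_, ?_, fun θ h x hx => ?_,
    fun θ h => ?_⟩
  · have h : Integrable (fun s : ℝ => max s 0) ((Kernel.id : Kernel ℝ ℝ) x) := by
      rw [Kernel.id_apply]
      exact integrable_dirac (by simp)
    exact h
  · set μ := jointLaw F revealing q hq.measurable with hμ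
    have hprob : IsProbabilityMeasure μ := isProbabilityMeasure_jointLaw hq.measurable
    have hle : MeasurableSpace.comap (Prod.snd : ℝ × ℝ → ℝ) revealing.measurableSpace ≤
        Prod.instMeasurableSpace := measurable_snd.comap_le
    have hsf : SigmaFinite (μ.trim hle) := inferInstance
    have h1 : (fun z : ℝ × ℝ => q z.1) =ᵐ[μ] fun z => max z.2 0 := by
      refine Measure.ae_compProd_of_ae_ae (measurableSet_eq_fun (hq.measurable.comp measurable_fst)
        (hpm.comp measurable_snd)) ?_
      filter_upwards [(hF : ∀ᵐ θ ∂F, θ ∈ Icc θl θh)] with θ h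
      have h' : ∀ᵐ s ∂((Kernel.id : Kernel ℝ ℝ) (q θ)), q θ = max s 0 := by
        rw [Kernel.id_apply, ae_dirac_iff (measurableSet_eq_fun measurable_const hpm),
          max_eq_left (hq.nonneg θ h)]
      rw [Kernel.comap_apply]
      exact h'
    have h2 : Integrable (fun z : ℝ × ℝ => max z.2 0) μ :=
      hq.integrable_quality.congr h1
    refine Filter.EventuallyEq.symm ((condExp_congr_ae h1).trans ?_)
    rw [condExp_of_stronglyMeasurable hle _ h2]
    exact (hpm.comp (comap_measurable Prod.snd)).stronglyMeasurable
  · simp only [payoff]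
    rw [expectedPrice_revealing hx, expectedPrice_revealing (hq.nonneg θ h)]
    exact hC.surplus_le_of_isFirstBest h (hqFB θ h) hx
  · simp only [payoff]
    rw [expectedPrice_revealing (hq.nonneg θ h)]
    simpa [hC.zero θ h] using hC.surplus_le_of_isFirstBest h (hqFB θ h) le_rfl

theorem welfare_revealing {C : ℝ → ℝ → ℝ} {θl θh : ℝ} (hC : IsCost C θl θh)
    {F : Measure ℝ} (hF : F (Icc θl θh)ᶜ = 0) (lam : ℝ → ℝ) {q : ℝ → ℝ}
    (hqFB : ∀ θ ∈ Icc θl θh, IsFirstBest C θ (q θ)) :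
    welfare C F lam revealing q (fun s : ℝ => max s 0) = ∫ θ, lam θ * maxSurplus C θ ∂F := by
  refine integral_congr_ae ?_
  filter_upwards [(hF : ∀ᵐ θ ∂F, θ ∈ Icc θl θh)] with θ h
  have h0 := hqFB θ h
  simp only [payoff]
  rw [expectedPrice_revealing h0.1, (hC.surplus_eq_maxSurplus_iff h ⟨_, h0⟩ h0.1).2 h0]

namespace IsEquilibrium

variable {C : ℝ → ℝ → ℝ} {θl θh : ℝ} {F : Measure ℝ} {R : RatingSystem} {q : ℝ → ℝ}
  {p : R.Signal → ℝ} {lam : ℝ → ℝ}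

/-- This is the layer-cake formula for the weights. Clamping extends λ monotonically to the whole
line, so its superlevel sets are upper sets and each inner integral is nonnegative. -/
theorem integral_maxSurplus_sub_welfare [IsProbabilityMeasure F]
    (E : IsEquilibrium C θl θh F R q p)
    (hC : IsCost C θl θh) (hθ : θl < θh) (hFB : ∀ θ ∈ Icc θl θh, ∃ x, IsFirstBest C θ x)
    (hF : F (Icc θl θh)ᶜ = 0) (hlam_nonneg : ∀ θ ∈ Icc θl θh, 0 ≤ lam θ)
    (hlam : StrictMonoOn lam (Icc θl θh)) :
    ∫ θ, lam θ * maxSurplus C θ ∂F - welfare C F lam R q p =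
      ∫ t in Ico 0 (lam θh), ∫ θ in {θ | t < lam (clamp θl θh θ)},
        (maxSurplus C θ - payoff C R p (q θ) θ) ∂F := by
  have hL := monotone_comp_clamp hθ hlam.monotoneOn
  have i1 := hC.integrable_maxSurplus hθ hFB hF
  have i2 := E.integrable_payoff hC hθ hF
  have hLm : AEStronglyMeasurable lam F :=
    hL.measurable.aestronglyMeasurable.congr (ae_comp_clamp hF lam)
  have hLb : ∀ᵐ θ ∂F, ‖lam θ‖ ≤ lam θh := by
    filter_upwards [(hF : ∀ᵐ θ ∂F, θ ∈ Icc θl θh)] with θ h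
    rw [Real.norm_eq_abs, abs_of_nonneg (hlam_nonneg θ h)]
    exact hlam.monotoneOn h ⟨hθ.le, le_rfl⟩ h.2
  have h := integral_mul_eq_integral_superlevel hL.measurable (i1.sub i2)
    (fun θ => hlam_nonneg _ (clamp_mem hθ θ))
    (fun θ => hlam.monotoneOn (clamp_mem hθ θ) ⟨hθ.le, le_rfl⟩ (clamp_mem hθ θ).2)
  simp only [Pi.sub_apply] at h
  rw [← h, welfare,
    ← integral_sub (i1.bdd_mul hLm hLb) (i2.bdd_mul hLm hLb)]
  refine integral_congr_ae ?_
  filter_upwards [ae_comp_clamp hF lam] with θ h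
  rw [h]
  ring

theorem superlevel_nonneg [IsProbabilityMeasure F] (E : IsEquilibrium C θl θh F R q p)
    (hC : IsCost C θl θh) (hθ : θl < θh) (hFB : ∀ θ ∈ Icc θl θh, ∃ x, IsFirstBest C θ x)
    (hF : F (Icc θl θh)ᶜ = 0) (hlam : StrictMonoOn lam (Icc θl θh)) (t : ℝ) :
    0 ≤ ∫ θ in {θ | t < lam (clamp θl θh θ)}, (maxSurplus C θ - payoff C R p (q θ) θ) ∂F := by
  have hL := monotone_comp_clamp hθ hlam.monotoneOn
  rw [integral_sub (hC.integrable_maxSurplus hθ hFB hF).integrableOn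
    (E.integrable_payoff hC hθ hF).integrableOn, sub_nonneg]
  exact E.setIntegral_payoff_le hC hθ hFB hF (measurableSet_lt measurable_const hL.measurable)
    fun θ θ' hle (h : t < _) => h.trans_le (hL hle)

theorem welfare_le [IsProbabilityMeasure F] (E : IsEquilibrium C θl θh F R q p)
    (hC : IsCost C θl θh) (hθ : θl < θh) (hFB : ∀ θ ∈ Icc θl θh, ∃ x, IsFirstBest C θ x)
    (hF : F (Icc θl θh)ᶜ = 0) (hlam_nonneg : ∀ θ ∈ Icc θl θh, 0 ≤ lam θ)
    (hlam : StrictMonoOn lam (Icc θl θh)) :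
    welfare C F lam R q p ≤ ∫ θ, lam θ * maxSurplus C θ ∂F := by
  rw [← sub_nonneg, E.integral_maxSurplus_sub_welfare hC hθ hFB hF hlam_nonneg hlam]
  exact integral_nonneg fun t => E.superlevel_nonneg hC hθ hFB hF hlam t

theorem payoff_eq_maxSurplus [IsProbabilityMeasure F] (E : IsEquilibrium C θl θh F R q p)
    (hC : IsCost C θl θh) (hθ : θl < θh) (hFB : ∀ θ ∈ Icc θl θh, ∃ x, IsFirstBest C θ x)
    (hF_cont : ∀ θ, F {θ} = 0) (hF : F (Icc θl θh)ᶜ = 0)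
    (hlam_nonneg : ∀ θ ∈ Icc θl θh, 0 ≤ lam θ) (hlam : StrictMonoOn lam (Icc θl θh))
    (hW : ∫ θ, lam θ * maxSurplus C θ ∂F ≤ welfare C F lam R q p) :
    ∀ᵐ θ ∂F, payoff C R p (q θ) θ = maxSurplus C θ := by
  have hL := monotone_comp_clamp hθ hlam.monotoneOn
  have hg := (hC.integrable_maxSurplus hθ hFB hF).sub (E.integrable_payoff hC hθ hF)
  have h1 := E.integral_maxSurplus_sub_welfare hC hθ hFB hF hlam_nonneg hlam
  rw [sub_eq_zero.2 (hW.antisymm (E.welfare_le hC hθ hFB hF hlam_nonneg hlam)), eq_comm,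
    integral_eq_zero_iff_of_nonneg (fun t => E.superlevel_nonneg hC hθ hFB hF hlam t)
      (integrableOn_integral_superlevel hL.measurable hg _)] at h1
  have h2 := ae_eq_zero_of_superlevel (L := fun θ => lam (clamp θl θh θ)) hF_cont hF hL.measurable
    hg (fun θ _ => hlam_nonneg _ (clamp_mem hθ θ))
    (fun θ h θ' h' hlt => by
      simp only [clamp_of_mem h, clamp_of_mem h']
      exact hlam h h' hlt)
    (by rw [clamp_of_mem ⟨hθ.le, le_rfl⟩]; exact h1)
  filter_upwards [h2] with θ h
  exact (sub_eq_zero.1 h).symm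

end IsEquilibrium

/-- Expected prices average to qualities, so that sellers who earn maximal surplus produce
first-best quality and are paid for it. -/
theorem IsEquilibrium.isFirstBest_and_expectedPrice_eq {C : ℝ → ℝ → ℝ} {θl θh : ℝ}
    {F : Measure ℝ} [IsProbabilityMeasure F] {R : RatingSystem} {q : ℝ → ℝ} {p : R.Signal → ℝ}
    (E : IsEquilibrium C θl θh F R q p) (hC : IsCost C θl θh)
    (hFB : ∀ θ ∈ Icc θl θh, ∃ x, IsFirstBest C θ x) (hF : F (Icc θl θh)ᶜ = 0)
    (h : ∀ᵐ θ ∂F, payoff C R p (q θ) θ = maxSurplus C θ) :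
    ∀ᵐ θ ∂F, IsFirstBest C θ (q θ) ∧ expectedPrice R p (q θ) = q θ := by
  have hae : ∀ᵐ θ ∂F, θ ∈ Icc θl θh := hF
  have h0 : 0 ≤ᵐ[F] fun θ => expectedPrice R p (q θ) - q θ := by
    filter_upwards [hae, h] with θ hI hp
    have := hC.surplus_le_maxSurplus hI (hFB θ hI) (E.allocation.nonneg θ hI)
    simp only [payoff] at hp
    simp only [Pi.zero_apply]
    linarith
  -- With the constant test function 1, mean price equals mean quality.
  have hb : ∀ _ : ℝ, |(1 : ℝ)| ≤ 1 := fun _ => abs_one.le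
  have h1 := (E.integral_mul_sub_eq_zero measurable_const hb).symm.trans
    (E.integral_expectedPrice_sub hF measurable_const hb)
  simp only [one_mul] at h1
  have h2 := (integral_eq_zero_iff_of_nonneg_ae h0
    (E.integrable_expectedPrice.sub E.allocation.integrable)).1 h1.symm
  filter_upwards [hae, h, h2] with θ hI hp hz
  have hz' : expectedPrice R p (q θ) = q θ := sub_eq_zero.1 hz
  refine ⟨(hC.surplus_eq_maxSurplus_iff hI (hFB θ hI) (E.allocation.nonneg θ hI)).1 ?_, hz'⟩
  rw [← hp, payoff, hz']

theorem isOptimalRating_revealing {C : ℝ → ℝ → ℝ} {θl θh : ℝ} (hC : IsCost C θl θh)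
    (hθ : θl < θh) {F : Measure ℝ} [IsProbabilityMeasure F] (hF : F (Icc θl θh)ᶜ = 0)
    {lam : ℝ → ℝ} (hlam_nonneg : ∀ θ ∈ Icc θl θh, 0 ≤ lam θ)
    (hlam : StrictMonoOn lam (Icc θl θh)) {q : ℝ → ℝ} (hq : IsAllocation θl θh F q)
    (hqFB : ∀ θ ∈ Icc θl θh, IsFirstBest C θ (q θ)) :
    IsOptimalRating C θl θh F lam revealing q (fun s : ℝ => max s 0) := by
  refine ⟨isEquilibrium_revealing hC hF hq hqFB, fun R' q' p' E' => ?_⟩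
  rw [welfare_revealing hC hF lam hqFB]
  exact E'.welfare_le hC hθ (fun θ h => ⟨_, hqFB θ h⟩) hF hlam_nonneg hlam

theorem exists_isAllocation_isFirstBest {C : ℝ → ℝ → ℝ} {θl θh : ℝ} (hC : IsCost C θl θh)
    (hθ : θl < θh) (hFB : ∀ θ ∈ Icc θl θh, ∃ x, IsFirstBest C θ x) {F : Measure ℝ}
    [IsProbabilityMeasure F] (hF : F (Icc θl θh)ᶜ = 0) :
    ∃ q, IsAllocation θl θh F q ∧ ∀ θ ∈ Icc θl θh, IsFirstBest C θ (q θ) := by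
  have hm := hC.monotoneOn_leastFirstBest hθ hFB
  have hfb : ∀ θ ∈ Icc θl θh, IsFirstBest C θ (leastFirstBest C (clamp θl θh θ)) := fun θ h => by
    rw [clamp_of_mem h]
    exact hC.isFirstBest_leastFirstBest h (hFB θ h)
  exact ⟨fun θ => leastFirstBest C (clamp θl θh θ), ⟨(monotone_comp_clamp hθ hm).measurable,
    fun θ h => (hfb θ h).1,
    (integrable_of_monotoneOn hθ hF hm).congr (ae_comp_clamp hF _).symm⟩, hfb⟩

theorem IsOptimalRating.isFirstBest_and_expectedPrice_eq {C : ℝ → ℝ → ℝ} {θl θh : ℝ}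
    {F : Measure ℝ} [IsProbabilityMeasure F] {R : RatingSystem} {q : ℝ → ℝ} {p : R.Signal → ℝ}
    {lam : ℝ → ℝ} (hopt : IsOptimalRating C θl θh F lam R q p) (hC : IsCost C θl θh)
    (hθ : θl < θh) (hFB : ∀ θ ∈ Icc θl θh, ∃ x, IsFirstBest C θ x)
    (hF_cont : ∀ θ, F {θ} = 0) (hF : F (Icc θl θh)ᶜ = 0)
    (hlam_nonneg : ∀ θ ∈ Icc θl θh, 0 ≤ lam θ) (hlam : StrictMonoOn lam (Icc θl θh)) :
    ∀ᵐ θ ∂F, IsFirstBest C θ (q θ) ∧ expectedPrice R p (q θ) = q θ := by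
  obtain ⟨q₀, hq₀, hfb₀⟩ := exists_isAllocation_isFirstBest hC hθ hFB hF
  have hW := hopt.2 _ _ _ (isEquilibrium_revealing hC hF hq₀ hfb₀)
  rw [welfare_revealing hC hF lam hfb₀] at hW
  exact hopt.1.isFirstBest_and_expectedPrice_eq hC hFB hF
    (hopt.1.payoff_eq_maxSurplus hC hθ hFB hF_cont hF hlam_nonneg hlam hW)

end RatingDesign

/-! ### The proposition -/

theorem mainTheorem5
    (θl θh : ℝ) (hθ : θl < θh)
    (C : ℝ → ℝ → ℝ) (hC : RatingDesign.IsCost C θl θh)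
    (hFB : ∀ θ ∈ Icc θl θh, ∃ x, RatingDesign.IsFirstBest C θ x)
    (F : Measure ℝ) [IsProbabilityMeasure F] (hF_cont : ∀ θ, F {θ} = 0)
    (hF : F (Icc θl θh)ᶜ = 0)
    (lam : ℝ → ℝ) (hlam_nonneg : ∀ θ ∈ Icc θl θh, 0 ≤ lam θ)
    (hlam : StrictMonoOn lam (Icc θl θh)) :
    -- up to `F`-null sets of types, the optimal allocations are exactly the first-best ones
    (∀ q : ℝ → ℝ, RatingDesign.IsAllocation θl θh F q →
      ((∃ q' : ℝ → ℝ, q' =ᵐ[F] q ∧ RatingDesign.IsOptimalAllocation C θl θh F lam q') ↔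
        ∀ᵐ θ ∂F, RatingDesign.IsFirstBest C θ (q θ))) ∧
    -- an allocation that is first best at every type is itself optimal
    (∀ q : ℝ → ℝ, RatingDesign.IsAllocation θl θh F q →
      (∀ θ ∈ Icc θl θh, RatingDesign.IsFirstBest C θ (q θ)) →
        RatingDesign.IsOptimalAllocation C θl θh F lam q) ∧
    -- every optimal rating system is fully revealing
    (∀ (R : RatingDesign.RatingSystem) (q : ℝ → ℝ) (p : R.Signal → ℝ),
      RatingDesign.IsOptimalRating C θl θh F lam R q p →
        RatingDesign.FullyRevealing F R q) := by
  refine ⟨fun q hq => ⟨?_, fun hfb => ?_⟩, fun q hq hfb => ?_, fun R q p hopt => ?_⟩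
  · rintro ⟨q', hqq', R, p, hopt⟩
    filter_upwards [hqq', hopt.isFirstBest_and_expectedPrice_eq hC hθ hFB hF_cont hF hlam_nonneg
      hlam] with θ h1 h2
    exact h1 ▸ h2.1
  · obtain ⟨q₀, hq₀, hfb₀⟩ := RatingDesign.exists_isAllocation_isFirstBest hC hθ hFB hF
    -- Incentives must hold at every type, so q is replaced by a first-best selection on a
    -- measurable null set containing all exceptional types.
    obtain ⟨T, hT, hTm, hT0⟩ := exists_measurable_superset_of_null (ae_iff.1 hfb)
    classical
    have hae : T.piecewise q₀ q =ᵐ[F] q := by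
      filter_upwards [compl_mem_ae_iff.2 hT0] with θ h
      exact piecewise_eq_of_notMem _ _ _ h
    have hfb' : ∀ θ ∈ Icc θl θh, RatingDesign.IsFirstBest C θ (T.piecewise q₀ q θ) := by
      intro θ h
      by_cases hθT : θ ∈ T
      · rw [piecewise_eq_of_mem _ _ _ hθT]; exact hfb₀ θ h
      · rw [piecewise_eq_of_notMem _ _ _ hθT]; exact not_not.1 fun hn => hθT (hT hn)
    exact ⟨_, hae, _, _, RatingDesign.isOptimalRating_revealing hC hθ hF hlam_nonneg hlam
      ⟨hq₀.measurable.piecewise hTm hq.measurable, fun θ h => (hfb' θ h).1,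
        hq.integrable.congr hae.symm⟩ hfb'⟩
  · exact ⟨_, _, RatingDesign.isOptimalRating_revealing hC hθ hF hlam_nonneg hlam hq hfb⟩
  · refine ⟨p, hopt.1.price_measurable, hopt.1.price_eq_quality hF ?_⟩
    filter_upwards [hopt.isFirstBest_and_expectedPrice_eq hC hθ hFB hF_cont hF hlam_nonneg
      hlam] with θ h
    exact h.2
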